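/- For each $n\ge 1$ let $|\phi_n\rangle\in\mathcal H_A^{(n)}\otimes\mathcal H_B^{(n)}$ be a unit vector in a tensor product of finite-dimensional complex Hilbert spaces, with no relation assumed between different $n$, and let $\rho=\{\rho_n\}$ be the sequence of subsystem states, $\rho_n=\mathrm{Tr}_A|\phi_n\rangle\langle\phi_n|$ for all $n$, or $\rho_n=\mathrm{Tr}_B|\phi_n\rangle\langle\phi_n|$ for all $n$. The sup-spectral entropy rate of $\rho$ is $$\overline S(\rho)=-\sup\Big\{\gamma\in\mathbb R:\ \liminf_{n\to\infty}\mathrm{Tr}\big[\{\rho_n-e^{n\gamma}I\ge 0\}(\rho_n-e^{n\gamma}I)\big]=1\Big\},$$ where $\{X\ge 0\}$ is the projection onto the span of the eigenvectors of the self-adjoint operator $X$ with non-negative eigenvalues. A concentration (distillation) protocol consists of integers $M_n\ge 1$ and LOCC operations $\mathcal T_n$ (local operations with two-way classical communication, in finitely many rounds) from $\mathcal H_A^{(n)}\otimes\mathcal H_B^{(n)}$ to $\mathbb C^{M_n}\otimes\mathbb C^{M_n}$. Its fidelities are $F_n=\langle\Psi^+_{M_n}|\mathcal T_n(|\phi_n\rangle\langle\phi_n|)|\Psi^+_{M_n}\rangle$,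 where $|\Psi^+_M\rangle=M^{-1/2}\sum_{i=1}^M|i\rangle\otimes|i\rangle$. It has rate $R\in\mathbb R$ if $\frac1n\log M_n\ge R$ for all sufficiently large $n$ (natural logarithm), and asymptotic fidelity zero if $\lim_{n\to\infty}F_n=0$. Let the strong converse rate $E_D^*$ be the infimum of all $R\in\mathbb R$ such that every protocol of rate $R$ has asymptotic fidelity zero. Then $$E_D^*=\overline S(\rho),$$ for either choice of the subsystem. (Infima and suprema are taken in $[-\infty,\infty]$; both sides may equal $+\infty$.) -/

import Mathlib

open Filter Topology
open scoped Kronecker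

/-!
Bipartite quantum systems are written in fixed orthonormal product bases: the system
`ℂ^a ⊗ ℂ^b` has the index type `Fin a × Fin b`, its vectors form
`EuclideanSpace ℂ (Fin a × Fin b)`, and operators on it are complex matrices.
-/

namespace EntanglementConcentration

/-- Operators on the bipartite system `ℂ^a ⊗ ℂ^b`. -/
abbrev BipartiteOp (a b : ℕ) : Type := Matrix (Fin a × Fin b) (Fin a × Fin b) ℂ

/-- The density matrix `|ψ⟩⟨ψ|`. -/
noncomputable def pureState {a b : ℕ} (ψ : EuclideanSpace ℂ (Fin a × Fin b)) :
    BipartiteOp a b :=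
  Matrix.of fun i j => ψ i * star (ψ j)

/-- The partial trace over the first party. -/
def traceA {a b : ℕ} (X : BipartiteOp a b) : Matrix (Fin b) (Fin b) ℂ :=
  Matrix.of fun i j => ∑ k, X (k, i) (k, j)

/-- The partial trace over the second party. -/
def traceB {a b : ℕ} (X : BipartiteOp a b) : Matrix (Fin a) (Fin a) ℂ :=
  Matrix.of fun i j => ∑ k, X (i, k) (j, k)

/-! ### Spectral entropy rates -/

/-- The spectral projection `{A ≥ 0}` of a self-adjoint matrix `A`. -/
noncomputable def nonnegProj {d : ℕ} (A : Matrix (Fin d) (Fin d) ℂ) :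
    Matrix (Fin d) (Fin d) ℂ :=
  cfc (fun x : ℝ => if 0 ≤ x then (1 : ℝ) else 0) A

/-- The difference operator `Π_n(γ) = ρ_n - e^{nγ} ω_n`. -/
noncomputable def diffOp {d : ℕ → ℕ} (ρ ω : ∀ n, Matrix (Fin (d n)) (Fin (d n)) ℂ)
    (γ : ℝ) (n : ℕ) : Matrix (Fin (d n)) (Fin (d n)) ℂ :=
  ρ n - (Real.exp (n * γ) : ℂ) • ω n

/-- The inf-spectral divergence rate
`sup {γ : liminf_n Tr[{Π_n(γ) ≥ 0} Π_n(γ)] = 1}`, as an extended real number. -/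
noncomputable def infDivergenceRate {d : ℕ → ℕ}
    (ρ ω : ∀ n, Matrix (Fin (d n)) (Fin (d n)) ℂ) : EReal :=
  sSup ((fun γ : ℝ => (γ : EReal)) ''
    {γ : ℝ | liminf (fun n =>
      ((nonnegProj (diffOp ρ ω γ n) * diffOp ρ ω γ n).trace).re) atTop = 1})

/-- The sup-spectral entropy rate `S̄(ρ) = - D̲(ρ ‖ I)`. -/
noncomputable def supEntropyRate {d : ℕ → ℕ}
    (ρ : ∀ n, Matrix (Fin (d n)) (Fin (d n)) ℂ) : EReal :=
  -infDivergenceRate ρ (fun _ => 1)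

/-! ### LOCC operations -/

/-- `IsLOCC T`: the map `T` from operators on `ℂ^a ⊗ ℂ^b` to operators on `ℂ^c ⊗ ℂ^d` is
implemented by local operations and two-way classical communication in finitely many rounds.
In each round one party performs a local measurement with Kraus operators `K i`
(`∑ i, K i† K i = 1`, the post-measurement space may depend on the outcome `i`), the outcome is
announced, and the parties continue with an LOCC operation that may depend on it. The outcomes
are forgotten at the end. Adjoining or discarding local ancillas, local channels and
shared randomness are special cases. -/
inductive IsLOCC {c d : ℕ} : {a b : ℕ} → (BipartiteOp a b → BipartiteOp c d) → Prop
  | done : IsLOCC (fun X : BipartiteOp c d => X)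
  | alice {a b m : ℕ} (k : Fin m → ℕ) (K : ∀ i, Matrix (Fin (k i)) (Fin a) ℂ)
      (hK : ∑ i, (K i).conjTranspose * K i = 1)
      (T : ∀ i, BipartiteOp (k i) b → BipartiteOp c d) (hT : ∀ i, IsLOCC (T i)) :
      IsLOCC (fun X : BipartiteOp a b =>
        ∑ i, T i ((K i ⊗ₖ (1 : Matrix (Fin b) (Fin b) ℂ)) * X *
          (K i ⊗ₖ (1 : Matrix (Fin b) (Fin b) ℂ)).conjTranspose))
  | bob {a b m : ℕ} (k : Fin m → ℕ) (K : ∀ i, Matrix (Fin (k i)) (Fin b) ℂ)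
      (hK : ∑ i, (K i).conjTranspose * K i = 1)
      (T : ∀ i, BipartiteOp a (k i) → BipartiteOp c d) (hT : ∀ i, IsLOCC (T i)) :
      IsLOCC (fun X : BipartiteOp a b =>
        ∑ i, T i (((1 : Matrix (Fin a) (Fin a) ℂ) ⊗ₖ K i) * X *
          ((1 : Matrix (Fin a) (Fin a) ℂ) ⊗ₖ K i).conjTranspose))

/-! ### Entanglement concentration -/

/-- The maximally entangled vector `M^{-1/2} ∑ i, |i⟩ ⊗ |i⟩`. -/
noncomputable def maxEntangled (M : ℕ) : EuclideanSpace ℂ (Fin M × Fin M) :=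
  WithLp.toLp 2 fun p => if p.1 = p.2 then ((Real.sqrt M : ℂ))⁻¹ else 0

/-- The fidelity `Tr[X |Ψ⟩⟨Ψ|]` of an output operator `X` with the maximally entangled
state `Ψ` of rank `M`. -/
noncomputable def fidelity {M : ℕ} (X : BipartiteOp M M) : ℝ :=
  ((X * pureState (maxEntangled M)).trace).re

/-- An entanglement concentration (distillation) protocol: for each `n` the rank `M n ≥ 1` of
the maximally entangled target state and an LOCC operation producing the output. -/
structure Protocol (a b : ℕ → ℕ) where
  M : ℕ → ℕ
  M_pos : ∀ n, 0 < M n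
  T : ∀ n, BipartiteOp (a n) (b n) → BipartiteOp (M n) (M n)
  isLOCC : ∀ n, IsLOCC (T n)

/-- The protocol operates at rate (at least) `R`: `(1/n) log M_n ≥ R` for all large `n`. -/
def Protocol.HasRate {a b : ℕ → ℕ} (P : Protocol a b) (R : ℝ) : Prop :=
  ∀ᶠ n : ℕ in atTop, R ≤ Real.log (P.M n) / n

/-- The fidelity `F_n` reached by the protocol on the initial pure state `φ_n`. -/
noncomputable def Protocol.fidelitySeq {a b : ℕ → ℕ} (P : Protocol a b)
    (φ : ∀ n, EuclideanSpace ℂ (Fin (a n) × Fin (b n))) (n : ℕ) : ℝ :=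
  fidelity (P.T n (pureState (φ n)))

/-- The strong converse rate: the infimum (in the extended reals) of all real `R` such that
every protocol of rate `R` has asymptotic fidelity zero, that is `F_n → 0`. -/
noncomputable def strongConverseRate {a b : ℕ → ℕ}
    (φ : ∀ n, EuclideanSpace ℂ (Fin (a n) × Fin (b n))) : EReal :=
  sInf ((fun R : ℝ => (R : EReal)) ''
    {R : ℝ | ∀ P : Protocol a b, P.HasRate R →
      Tendsto (P.fidelitySeq φ) atTop (𝓝 0)})

end EntanglementConcentration

namespace EntanglementConcentration

open Matrix
open scoped ComplexOrder

/-! ### The excess of a spectrum over a threshold -/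

/-! A bipartite vector is handled through its coefficient matrix `A`: local operators multiply `A`
on the left or right, and the overlap with the maximally entangled vector is `tr A / √M`. If `w`
lists the squared Schmidt coefficients, the trace in the entropy rate is the excess E(t) = ∑ max (w
i - t) 0 at t = exp (n γ), and normalisation gives 1 - E(t) = ∑ min (w i) t. The theorem follows
from two bounds for a single state.

Converse (`IsLOCC.fidelity_le_excess`): every LOCC map has F ≤ 2 / (M t) + 2 (1 - E(t)). At most 1 /
t weights reach t, so they span a part of Schmidt rank at most 1 / t, which LOCC cannot raise; the
remaining mass is at most 1 - E(t).

Direct (`exists_isLOCC_fidelity_ge`): some LOCC map has F ≥ 1 - E(t) - M t for all t ≥ 0. Projecting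
onto blocks of M consecutive Schmidt vectors, in decreasing order, each block yields at least the
mass of the next one, so only the mass of the first block can be lost.

With M about exp (n R), the first bound turns E → 1 into F → 0 whenever R > -γ, and the second
reverses this whenever γ < -R. The two marginals share their nonzero spectrum
(`excess_transpose_mul`), hence the excess. -/

/-- The quantity `Tr[{X - t ≥ 0} (X - t)]`. -/
noncomputable def excess {d : ℕ} (X : Matrix (Fin d) (Fin d) ℂ) (t : ℝ) : ℝ :=
  ((nonnegProj (X - (t : ℂ) • 1) * (X - (t : ℂ) • 1)).trace).re

theorem trace_cfc {d : ℕ} {X : Matrix (Fin d) (Fin d) ℂ} (hX : X.IsHermitian) (f : ℝ → ℝ) :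
    (cfc f X).trace = ∑ i, ((f (hX.eigenvalues i) : ℝ) : ℂ) := by
  rw [hX.cfc_eq, IsHermitian.cfc, Unitary.conjStarAlgAut_apply, trace_mul_cycle]
  simp [trace_diagonal]

theorem excess_eq_sum_eigenvalues {d : ℕ} {X : Matrix (Fin d) (Fin d) ℂ} (hX : X.IsHermitian)
    (t : ℝ) : excess X t = ∑ i, max (hX.eigenvalues i - t) 0 := by
  have hsa : IsSelfAdjoint X := hX
  have hfin : (spectrum ℝ X).Finite := hX.spectrum_real_eq_range_eigenvalues ▸ Set.finite_range _
  have hshift : X - (t : ℂ) • 1 = cfc (fun x : ℝ => x - t) X := by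
    rw [cfc_sub (fun x : ℝ => x) (fun _ => t) X, cfc_id' ℝ X, cfc_const t X]
    congr 1
    ext i j
    simp [algebraMap_matrix_apply, one_apply]
  have hg : nonnegProj (X - (t : ℂ) • 1) * (X - (t : ℂ) • 1)
      = cfc (fun x : ℝ => max (x - t) 0) X := by
    -- The indicator jumps at 0, but the spectrum is finite, so every function is continuous on it
    -- and the functional calculus composes.
    rw [nonnegProj, hshift, ← cfc_comp' (fun x : ℝ => if 0 ≤ x then (1 : ℝ) else 0)
      (fun x => x - t) X
      ((hfin.image _).continuousOn _) (hfin.continuousOn _),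
      ← cfc_mul _ _ X (hfin.continuousOn _) (hfin.continuousOn _)]
    congr 1
    ext x
    split_ifs with h
    · simp [h]
    · simp [le_of_lt (not_le.mp h)]
  rw [excess, hg, trace_cfc hX]
  simp

theorem excess_eq_sum_roots {d : ℕ} {X : Matrix (Fin d) (Fin d) ℂ} (hX : X.IsHermitian) (t : ℝ) :
    excess X t = (X.charpoly.roots.map fun z => max (z.re - t) 0).sum := by
  rw [excess_eq_sum_eigenvalues hX, hX.roots_charpoly_eq_eigenvalues, Multiset.map_map]
  rfl

-- The characteristic polynomials of the two marginals agree up to powers of `X`; the additional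
-- zero roots contribute `max (0 - t) 0 = 0`, which needs `0 ≤ t`.
open Polynomial in
theorem excess_transpose_mul {a b : ℕ} (A : Matrix (Fin a) (Fin b) ℂ) {t : ℝ} (ht : 0 ≤ t) :
    excess (Aᵀ * Aᵀᴴ) t = excess (A * Aᴴ) t := by
  have h : (X : ℂ[X]) ^ b * (A * Aᴴ).charpoly = X ^ a * (Aᵀ * Aᵀᴴ).charpoly := by
    have h1 := charpoly_mul_comm' A Aᴴ
    have h2 : Aᵀ * Aᵀᴴ = (Aᴴ * A)ᵀ := by
      rw [transpose_mul, conjTranspose, conjTranspose, transpose_map]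
    rw [h2, charpoly_transpose]
    simpa using h1
  have hr := congrArg (fun p : ℂ[X] => (p.roots.map fun z => max (z.re - t) 0).sum) h
  have hne : ∀ {d : ℕ} (Y : Matrix (Fin d) (Fin d) ℂ) (k : ℕ),
      ((X : ℂ[X]) ^ k * Y.charpoly) ≠ 0 := fun Y k =>
    mul_ne_zero (pow_ne_zero _ X_ne_zero) (charpoly_monic Y).ne_zero
  simp only [roots_mul (hne _ _), roots_X_pow, Multiset.map_add, Multiset.sum_add,
    Multiset.map_nsmul, Multiset.sum_nsmul, Multiset.map_singleton, Multiset.sum_singleton,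
    Complex.zero_re, zero_sub, max_eq_right (neg_nonpos.mpr ht), smul_zero, zero_add] at hr
  rw [excess_eq_sum_roots (isHermitian_mul_conjTranspose_self _),
    excess_eq_sum_roots (isHermitian_mul_conjTranspose_self _), hr]

/-- A Schmidt decomposition with decreasing Schmidt weights. -/
theorem exists_schmidt {a b : ℕ} (A : Matrix (Fin a) (Fin b) ℂ) :
    ∃ (U : Matrix (Fin a) (Fin a) ℂ) (w : Fin a → ℝ), Uᴴ * U = 1 ∧ U * Uᴴ = 1 ∧ Antitone w ∧
      (∀ i, 0 ≤ w i) ∧ (Uᴴ * A) * (Uᴴ * A)ᴴ = diagonal (fun i => (w i : ℂ)) ∧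
      ∀ t, excess (A * Aᴴ) t = ∑ i, max (w i - t) 0 := by
  have hX := isHermitian_mul_conjTranspose_self A
  -- Sorting the negated eigenvalues puts the weights in decreasing order.
  set σ := Tuple.sort (fun i => -hX.eigenvalues i) with hσ
  set V : Matrix (Fin a) (Fin a) ℂ := ↑hX.eigenvectorUnitary with hV
  have hV1 : Vᴴ * V = 1 := Unitary.coe_star_mul_self hX.eigenvectorUnitary
  have hU1 : (V.submatrix id σ)ᴴ * V.submatrix id σ = 1 := by
    have h := submatrix_mul_equiv Vᴴ V σ (Equiv.refl _) σ
    rw [hV1, submatrix_one_equiv] at h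
    rw [conjTranspose_submatrix]
    exact h
  refine ⟨V.submatrix id σ, fun i => hX.eigenvalues (σ i), hU1, mul_eq_one_comm.mp hU1, ?_, ?_,
    ?_, ?_⟩
  · intro i j hij
    have := Tuple.monotone_sort (fun i => -hX.eigenvalues i) hij
    simpa [hσ] using this
  · exact fun i => (posSemidef_self_mul_conjTranspose A).eigenvalues_nonneg _
  · have h := hX.conjStarAlgAut_star_eigenvectorUnitary
    rw [Unitary.conjStarAlgAut_star_apply] at h
    have h' : Vᴴ * (A * Aᴴ) * V = diagonal (fun i => (hX.eigenvalues i : ℂ)) := h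
    have : (V.submatrix id σ)ᴴ * A * ((V.submatrix id σ)ᴴ * A)ᴴ
        = (Vᴴ * (A * Aᴴ) * V).submatrix σ σ := by
      rw [conjTranspose_mul, conjTranspose_conjTranspose, conjTranspose_submatrix]
      ext i j
      simp only [← Matrix.mul_assoc]
      simp [mul_apply]
    rw [this, h', submatrix_diagonal_equiv]
    rfl
  · intro t
    rw [excess_eq_sum_eigenvalues hX]
    exact (Equiv.sum_comp σ fun i => max (hX.eigenvalues i - t) 0).symm

/-! ### The squared Frobenius norm -/

/-- The squared Frobenius norm. -/
noncomputable def frobSq {m n : Type*} [Fintype m] [Fintype n] (A : Matrix m n ℂ) : ℝ :=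
  ∑ i, ∑ j, ‖A i j‖ ^ 2

section Frobenius

variable {l m n : Type*} [Fintype l] [Fintype m] [Fintype n]

theorem frobSq_nonneg (A : Matrix m n ℂ) : 0 ≤ frobSq A := by
  unfold frobSq; positivity

theorem frobSq_eq_trace (A : Matrix m n ℂ) : (frobSq A : ℂ) = (A * Aᴴ).trace := by
  simp [frobSq, trace, mul_apply, Complex.mul_conj']

theorem frobSq_eq_trace' (A : Matrix m n ℂ) : (frobSq A : ℂ) = (Aᴴ * A).trace := by
  rw [frobSq_eq_trace, trace_mul_comm]

theorem frobSq_transpose (A : Matrix m n ℂ) : frobSq Aᵀ = frobSq A := by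
  simp only [frobSq, transpose_apply]
  exact Finset.sum_comm

theorem frobSq_isometry_mul [DecidableEq m] (U : Matrix l m ℂ) (hU : Uᴴ * U = 1)
    (A : Matrix m n ℂ) : frobSq (U * A) = frobSq A := by
  have : (frobSq (U * A) : ℂ) = frobSq A := by
    rw [frobSq_eq_trace', frobSq_eq_trace', conjTranspose_mul, Matrix.mul_assoc,
      ← Matrix.mul_assoc Uᴴ, hU, Matrix.one_mul]
  exact_mod_cast this

/-- Conservation of probability over the outcomes of a measurement; it lets bounds linear in
`frobSq` pass through a round of LOCC. -/
theorem sum_frobSq_kraus [DecidableEq m] {r : ℕ} {k : Fin r → ℕ}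
    (K : ∀ i, Matrix (Fin (k i)) m ℂ) (hK : ∑ i, (K i)ᴴ * K i = 1) (A : Matrix m n ℂ) :
    ∑ i, frobSq (K i * A) = frobSq A := by
  have : ((∑ i, frobSq (K i * A) : ℝ) : ℂ) = frobSq A := by
    push_cast
    simp only [frobSq_eq_trace', conjTranspose_mul, Matrix.mul_assoc]
    rw [← trace_sum, ← Matrix.mul_sum]
    simp only [← Matrix.mul_assoc (_)ᴴ _ A]
    rw [← Matrix.sum_mul, hK, Matrix.one_mul]
  exact_mod_cast this

theorem norm_trace_mul_sq_le (A : Matrix m n ℂ) (B : Matrix n m ℂ) :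
    ‖(A * B).trace‖ ^ 2 ≤ frobSq A * frobSq B := by
  have h1 : ‖(A * B).trace‖ ≤ ∑ p : m × n, ‖A p.1 p.2‖ * ‖Bᵀ p.1 p.2‖ := by
    rw [trace, Fintype.sum_prod_type]
    refine (norm_sum_le _ _).trans (Finset.sum_le_sum fun i _ => ?_)
    rw [diag_apply, mul_apply]
    exact (norm_sum_le _ _).trans (Finset.sum_le_sum fun j _ => by simp)
  calc ‖(A * B).trace‖ ^ 2 ≤ (∑ p : m × n, ‖A p.1 p.2‖ * ‖Bᵀ p.1 p.2‖) ^ 2 := by gcongr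
    _ ≤ (∑ p : m × n, ‖A p.1 p.2‖ ^ 2) * ∑ p : m × n, ‖Bᵀ p.1 p.2‖ ^ 2 :=
      Finset.sum_mul_sq_le_sq_mul_sq _ _ _
    _ = frobSq A * frobSq B := by
      rw [← frobSq_transpose B, Fintype.sum_prod_type, Fintype.sum_prod_type]; rfl

end Frobenius

theorem sum_norm_sq_row {m n : Type*} [Fintype n] [DecidableEq m]
    {B : Matrix m n ℂ} {w : m → ℝ}
    (hw : B * Bᴴ = diagonal fun i => (w i :  ℂ)) (i : m) : ∑ j, ‖B i j‖ ^ 2 = w i := by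
  have := congrFun (congrFun hw i) i
  simp only [mul_apply, conjTranspose_apply, RCLike.star_def, Complex.mul_conj',
    diagonal_apply_eq] at this
  exact_mod_cast this


/-- Cauchy–Schwarz for the factorisation `A = (U * E) * B`, where `E` projects onto the nonzero rows
of `B`, so that `frobSq (U * E)` is the rank. -/
theorem norm_trace_sq_le_rank_mul {d : ℕ} (A : Matrix (Fin d) (Fin d) ℂ) :
    ‖A.trace‖ ^ 2 ≤ A.rank * frobSq A := by
  classical
  obtain ⟨U, w, hU, hU', -, -, hw, -⟩ := exists_schmidt A
  set B := Uᴴ * A with hB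
  have hA : A = U * B := by rw [hB, ← Matrix.mul_assoc, hU', Matrix.one_mul]
  set E : Matrix (Fin d) (Fin d) ℂ := diagonal fun i => if w i = 0 then 0 else 1 with hE
  have hrow := sum_norm_sq_row hw
  have hEB : E * B = B := by
    ext i j
    rw [hE, diagonal_mul]
    split_ifs with h
    · have := (Finset.sum_eq_zero_iff_of_nonneg (fun j _ => by positivity)).mp
        ((hrow i).trans h) j (Finset.mem_univ _)
      have : B i j = 0 := by simpa using this
      simp [this]
    · simp
  have hrank : A.rank = Fintype.card {i // w i ≠ 0} := by
    have h1 : B.rank = A.rank :=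
      rank_mul_eq_right_of_isUnit_det _ _
        ((isUnit_iff_isUnit_det _).mp (IsUnit.of_mul_eq_one _ hU))
    rw [← h1, ← rank_self_mul_conjTranspose, hw, rank_diagonal]
    simp
  have hfE : frobSq E = A.rank := by
    rw [hrank, Fintype.card_subtype, frobSq, Finset.card_filter]
    push_cast
    refine Finset.sum_congr rfl fun i _ => ?_
    rw [Finset.sum_eq_single i]
    · by_cases h : w i = 0 <;> simp [hE, h]
    · intro j _ hj; simp [hE, diagonal_apply_ne' _ hj]
    · simp
  calc ‖A.trace‖ ^ 2 = ‖(U * E * B).trace‖ ^ 2 := by rw [Matrix.mul_assoc, hEB, ← hA]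
    _ ≤ frobSq (U * E) * frobSq B := norm_trace_mul_sq_le _ _
    _ = A.rank * frobSq A := by
      rw [frobSq_isometry_mul U hU, hfE, hA, frobSq_isometry_mul U hU, ← hA]

/-! ### LOCC operations on pure states -/

/-- The density matrix of the vector with coefficient matrix `A`. -/
noncomputable def pureOp {a b : ℕ} (A : Matrix (Fin a) (Fin b) ℂ) : BipartiteOp a b :=
  vecMulVec (fun p => A p.1 p.2) (star fun p => A p.1 p.2)

theorem conj_pureOp {a b a' b' : ℕ} (Y : Matrix (Fin a' × Fin b') (Fin a × Fin b) ℂ)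
    (A : Matrix (Fin a) (Fin b) ℂ) (A' : Matrix (Fin a') (Fin b') ℂ)
    (h : Y *ᵥ (fun p => A p.1 p.2) = fun p => A' p.1 p.2) :
    Y * pureOp A * Yᴴ = pureOp A' := by
  rw [pureOp, mul_vecMulVec, vecMulVec_mul, h, ← star_mulVec, h, pureOp]

theorem alice_pureOp {a b k : ℕ} (K : Matrix (Fin k) (Fin a) ℂ) (A : Matrix (Fin a) (Fin b) ℂ) :
    (K ⊗ₖ (1 : Matrix (Fin b) (Fin b) ℂ)) * pureOp A * (K ⊗ₖ (1 : Matrix (Fin b) (Fin b) ℂ))ᴴ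
      = pureOp (K * A) := by
  refine conj_pureOp _ _ _ ?_
  ext p
  simp [mulVec, dotProduct, Fintype.sum_prod_type, one_apply, mul_apply]

theorem bob_pureOp {a b k : ℕ} (K : Matrix (Fin k) (Fin b) ℂ) (A : Matrix (Fin a) (Fin b) ℂ) :
    ((1 : Matrix (Fin a) (Fin a) ℂ) ⊗ₖ K) * pureOp A * ((1 : Matrix (Fin a) (Fin a) ℂ) ⊗ₖ K)ᴴ
      = pureOp (A * Kᵀ) := by
  refine conj_pureOp _ _ _ ?_
  ext p
  simp [mulVec, dotProduct, Fintype.sum_prod_type, one_apply, mul_apply, mul_comm]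

/-- The maximally entangled vector has coefficient matrix `M^{-1/2} • 1`, so its inner product with
any vector is a trace. -/
theorem fidelity_pureOp {M : ℕ} (A : Matrix (Fin M) (Fin M) ℂ) :
    fidelity (pureOp A) = ‖A.trace‖ ^ 2 / M := by
  have hP : pureState (maxEntangled M)
      = pureOp (((Real.sqrt M : ℂ))⁻¹ • (1 : Matrix (Fin M) (Fin M) ℂ)) := by
    ext p q
    simp [pureState, pureOp, maxEntangled, vecMulVec_apply, one_apply]
  have hs : ((Real.sqrt M : ℂ))⁻¹ * ((Real.sqrt M : ℂ))⁻¹ = ((M : ℝ) : ℂ)⁻¹ := by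
    rw [← mul_inv, ← Complex.ofReal_mul, Real.mul_self_sqrt (Nat.cast_nonneg M)]
  have h1 : ∑ p : Fin M × Fin M, A p.1 p.2 *
      (((Real.sqrt M : ℂ))⁻¹ • (1 : Matrix (Fin M) (Fin M) ℂ)) p.1 p.2
      = ((Real.sqrt M : ℂ))⁻¹ * A.trace := by
    rw [Fintype.sum_prod_type]
    simp [one_apply, trace, Finset.mul_sum, mul_comm]
  have h2 : ∑ p : Fin M × Fin M, star (A p.1 p.2) *
      (((Real.sqrt M : ℂ))⁻¹ • (1 : Matrix (Fin M) (Fin M) ℂ)) p.1 p.2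
      = ((Real.sqrt M : ℂ))⁻¹ * star A.trace := by
    rw [Fintype.sum_prod_type]
    simp [one_apply, trace, Finset.mul_sum, mul_comm]
  have h : (pureOp A * pureOp (((Real.sqrt M : ℂ))⁻¹ • (1 : Matrix (Fin M) (Fin M) ℂ))).trace
      = (((‖A.trace‖ ^ 2 / M : ℝ)) : ℂ) := by
    have : (pureOp A * pureOp (((Real.sqrt M : ℂ))⁻¹ • (1 : Matrix (Fin M) (Fin M) ℂ))).trace
        = (∑ p : Fin M × Fin M, A p.1 p.2 *
            (((Real.sqrt M : ℂ))⁻¹ • (1 : Matrix (Fin M) (Fin M) ℂ)) p.1 p.2) *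
          ∑ p : Fin M × Fin M, star (A p.1 p.2) *
            (((Real.sqrt M : ℂ))⁻¹ • (1 : Matrix (Fin M) (Fin M) ℂ)) p.1 p.2 := by
      rw [Finset.sum_mul_sum]
      simp only [trace, diag_apply, mul_apply, pureOp, vecMulVec_apply, Pi.star_apply]
      refine Finset.sum_congr rfl fun p _ => Finset.sum_congr rfl fun q _ => ?_
      have hst : star ((((Real.sqrt M : ℂ))⁻¹ • (1 : Matrix (Fin M) (Fin M) ℂ)) p.1 p.2)
          = (((Real.sqrt M : ℂ))⁻¹ • (1 : Matrix (Fin M) (Fin M) ℂ)) p.1 p.2 := by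
        by_cases hpq : p.1 = p.2 <;> simp [one_apply, hpq]
      rw [hst]; ring
    rw [this, h1, h2]
    rw [show ∀ x y z : ℂ, x * y * (x * z) = x * x * (y * z) from fun x y z => by ring, hs,
      RCLike.star_def, Complex.mul_conj']
    push_cast
    ring
  rw [fidelity, hP, h, Complex.ofReal_re]

theorem fidelity_sum {M : ℕ} {ι : Type*} (s : Finset ι) (X : ι → BipartiteOp M M) :
    fidelity (∑ i ∈ s, X i) = ∑ i ∈ s, fidelity (X i) := by
  simp [fidelity, Matrix.sum_mul, trace_sum]

theorem IsLOCC.fidelity_nonneg {M a b : ℕ} {T : BipartiteOp a b → BipartiteOp M M}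
    (hT : IsLOCC T) (A : Matrix (Fin a) (Fin b) ℂ) : 0 ≤ fidelity (T (pureOp A)) := by
  induction hT with
  | done => rw [fidelity_pureOp]; positivity
  | alice k K hK T hT ih =>
    rw [fidelity_sum]
    exact Finset.sum_nonneg fun i _ => by rw [alice_pureOp]; exact ih i _
  | bob k K hK T hT ih =>
    rw [fidelity_sum]
    exact Finset.sum_nonneg fun i _ => by rw [bob_pureOp]; exact ih i _

/-- LOCC cannot raise the Schmidt rank: the fidelity reached from a sum of a vector of Schmidt rank
at most `N` and a remainder. -/
theorem IsLOCC.fidelity_le {M a b N : ℕ} {T : BipartiteOp a b → BipartiteOp M M}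
    (hT : IsLOCC T) (A B : Matrix (Fin a) (Fin b) ℂ) (hA : A.rank ≤ N) :
    fidelity (T (pureOp (A + B))) ≤ 2 * (N / M * frobSq A) + 2 * frobSq B := by
  induction hT with
  | done =>
    rw [fidelity_pureOp, trace_add]
    rcases Nat.eq_zero_or_pos M with rfl | hM
    · simpa using frobSq_nonneg B
    have hM' : (0 : ℝ) < M := by exact_mod_cast hM
    -- The factors 2 come from (x + y)² ≤ 2x² + 2y²; the trace bound is then used with rank `N` for
    -- `A` and the trivial rank `M` for `B`.
    have h0 : ‖A.trace + B.trace‖ ^ 2 ≤ 2 * ‖A.trace‖ ^ 2 + 2 * ‖B.trace‖ ^ 2 := by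
      nlinarith [norm_add_le A.trace B.trace, norm_nonneg (A.trace + B.trace),
        sq_nonneg (‖A.trace‖ - ‖B.trace‖), norm_nonneg A.trace, norm_nonneg B.trace]
    have h1 : ‖A.trace‖ ^ 2 ≤ N * frobSq A :=
      (norm_trace_sq_le_rank_mul A).trans
        (mul_le_mul_of_nonneg_right (by exact_mod_cast hA) (frobSq_nonneg A))
    have h2 : ‖B.trace‖ ^ 2 ≤ M * frobSq B :=
      (norm_trace_sq_le_rank_mul B).trans
        (mul_le_mul_of_nonneg_right (by exact_mod_cast rank_le_width B) (frobSq_nonneg B))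
    rw [div_le_iff₀ hM']
    have h3 : (2 * (N / M * frobSq A) + 2 * frobSq B) * M
        = 2 * (N * frobSq A) + 2 * (M * frobSq B) := by field_simp
    linarith
  | alice k K hK T hT ih =>
    -- Both sides split over the outcomes, and multiplication by a Kraus operator cannot raise the
    -- rank of the `A` part.
    rw [fidelity_sum, ← sum_frobSq_kraus K hK A, ← sum_frobSq_kraus K hK B]
    simp only [Finset.mul_sum, ← Finset.sum_add_distrib]
    refine Finset.sum_le_sum fun i _ => ?_
    rw [alice_pureOp, Matrix.mul_add]
    exact ih i _ _ ((rank_mul_le_right _ _).trans hA)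
  | bob k K hK T hT ih =>
    rw [fidelity_sum, ← frobSq_transpose A, ← frobSq_transpose B, ← sum_frobSq_kraus K hK Aᵀ,
      ← sum_frobSq_kraus K hK Bᵀ]
    simp only [Finset.mul_sum, ← Finset.sum_add_distrib]
    refine Finset.sum_le_sum fun i _ => ?_
    rw [bob_pureOp, Matrix.add_mul]
    refine (ih i _ _ ((rank_mul_le_left _ _).trans hA)).trans_eq ?_
    rw [← frobSq_transpose (K i * Aᵀ), ← frobSq_transpose (K i * Bᵀ), transpose_mul, transpose_mul,
      transpose_transpose, transpose_transpose]

/-! ### Strong converse bound in terms of the excess. -/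

theorem excess_nonneg {a b : ℕ} (A : Matrix (Fin a) (Fin b) ℂ) (t : ℝ) :
    0 ≤ excess (A * Aᴴ) t := by
  obtain ⟨U, w, -, -, -, -, -, hex⟩ := exists_schmidt A
  rw [hex]
  exact Finset.sum_nonneg fun i _ => le_max_right _ _

theorem sum_schmidt_weights {a b : ℕ} {A : Matrix (Fin a) (Fin b) ℂ} {w : Fin a → ℝ}
    {U : Matrix (Fin a) (Fin a) ℂ} (hU : U * Uᴴ = 1)
    (hw : (Uᴴ * A) * (Uᴴ * A)ᴴ = diagonal (fun i => (w i : ℂ))) : ∑ i, w i = frobSq A := by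
  have h : (frobSq A : ℂ) = ∑ i, (w i : ℂ) := by
    rw [← frobSq_isometry_mul Uᴴ (by rwa [conjTranspose_conjTranspose]) A, frobSq_eq_trace, hw,
      trace_diagonal]
  exact_mod_cast h.symm

theorem excess_le_one {a b : ℕ} {A : Matrix (Fin a) (Fin b) ℂ} (hA : frobSq A = 1) {t : ℝ}
    (ht : 0 ≤ t) : excess (A * Aᴴ) t ≤ 1 := by
  obtain ⟨U, w, -, hU, -, hw0, hw, hex⟩ := exists_schmidt A
  rw [hex, ← hA, ← sum_schmidt_weights hU hw]
  exact Finset.sum_le_sum fun i _ => max_le (by linarith) (hw0 i)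

/-- The strong converse bound. -/
theorem IsLOCC.fidelity_le_excess {M a b : ℕ} {T : BipartiteOp a b → BipartiteOp M M}
    (hT : IsLOCC T) {A : Matrix (Fin a) (Fin b) ℂ} (hA : frobSq A = 1) {t : ℝ} (ht : 0 < t) :
    fidelity (T (pureOp A)) ≤ 2 / (M * t) + 2 * (1 - excess (A * Aᴴ) t) := by
  classical
  obtain ⟨U, w, hU, hU', -, hw0, hw, hex⟩ := exists_schmidt A
  have hsum : ∑ i, w i = 1 := (sum_schmidt_weights hU' hw).trans hA
  set B := Uᴴ * A with hB
  have hrow := sum_norm_sq_row hw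
  -- `D` keeps the Schmidt components of weight at least `t`.
  set D : Matrix (Fin a) (Fin a) ℂ := diagonal fun i => if t ≤ w i then 1 else 0 with hD
  have hsplit : A = U * (D * B) + U * ((1 - D) * B) := by
    rw [← Matrix.mul_add, ← Matrix.add_mul, add_sub_cancel, Matrix.one_mul, hB, ← Matrix.mul_assoc,
      hU', Matrix.one_mul]
  have hfD : frobSq (U * (D * B)) = ∑ i, if t ≤ w i then w i else 0 := by
    rw [frobSq_isometry_mul U hU, frobSq]
    refine Finset.sum_congr rfl fun i _ => ?_
    by_cases h : t ≤ w i <;> simp [hD, diagonal_mul, h, hrow]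
  have hfD' : frobSq (U * ((1 - D) * B)) = ∑ i, if t ≤ w i then 0 else w i := by
    rw [frobSq_isometry_mul U hU, frobSq]
    refine Finset.sum_congr rfl fun i _ => ?_
    by_cases h : t ≤ w i <;> simp [hD, diagonal_mul, h, Matrix.sub_mul, hrow]
  set N := Fintype.card {i // t ≤ w i} with hN
  have hrank : (U * (D * B)).rank ≤ N := by
    refine (rank_mul_le_right _ _).trans ((rank_mul_le_left _ _).trans_eq ?_)
    rw [hD, rank_diagonal, hN]
    exact Fintype.card_congr (Equiv.subtypeEquivRight fun i => by simp)
  -- Markov's inequality for weights of total mass 1.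
  have hNt : N * t ≤ 1 := by
    rw [← hsum, hN, Fintype.card_subtype, Finset.card_filter]
    push_cast
    rw [Finset.sum_mul]
    refine Finset.sum_le_sum fun i _ => ?_
    split_ifs with h
    · simpa using h
    · simpa using hw0 i
  have h1 : frobSq (U * (D * B)) ≤ 1 := by
    rw [hfD, ← hsum]
    refine Finset.sum_le_sum fun i _ => ?_
    split_ifs
    · exact le_rfl
    · exact hw0 i
  have h2 : frobSq (U * ((1 - D) * B)) ≤ 1 - excess (A * Aᴴ) t := by
    rw [hfD', hex, ← hsum, ← Finset.sum_sub_distrib]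
    refine Finset.sum_le_sum fun i _ => ?_
    split_ifs with h
    · rw [max_eq_left (by linarith)]; linarith
    · rw [max_eq_right (by linarith)]; linarith
  have h3 : (N : ℝ) / M * frobSq (U * (D * B)) ≤ 1 / (M * t) := by
    calc (N : ℝ) / M * frobSq (U * (D * B)) ≤ N / M * 1 := by gcongr
      _ = N * t / (M * t) := by rw [mul_one, mul_div_mul_right _ _ ht.ne']
      _ ≤ 1 / (M * t) := by gcongr
  have h4 := hT.fidelity_le (U * (D * B)) (U * ((1 - D) * B)) hrank
  rw [← hsplit] at h4
  have h5 : 2 / (M * t) = 2 * (1 / (M * t)) := by ring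
  rw [h5]
  linarith

/-! ### A concentration protocol -/

/-- A local measurement of the second party one of whose outcomes turns a vector with orthogonal
rows into a vector in Schmidt form. -/
theorem exists_aligning_measurement {M b : ℕ} (hM : 0 < M) {X : Matrix (Fin M) (Fin b) ℂ}
    {v : Fin M → ℝ} (hv : ∀ j, 0 ≤ v j) (hX : X * Xᴴ = diagonal fun j => (v j : ℂ)) :
    ∃ K : Fin (b + 1) → Matrix (Fin M) (Fin b) ℂ, ∑ i, (K i)ᴴ * K i = 1 ∧
      (X * (K 0)ᵀ).trace = ((∑ j, Real.sqrt (v j) : ℝ) : ℂ) := by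
  classical
  -- For zero weights the convention `0⁻¹ = 0` applies, so `W` below is a partial isometry even when
  -- rows of `X` vanish.
  set s : Fin M → ℂ := fun j => ((Real.sqrt (v j) : ℂ))⁻¹ with hs
  have hss : star s = s := by ext j; simp [hs]
  set W : Matrix (Fin M) (Fin b) ℂ := diagonal s * Xᴴᵀ with hW
  have hWt : Wᵀ = Xᴴ * diagonal s := by
    rw [hW, transpose_mul, transpose_transpose, diagonal_transpose]
  have hWh : Wᴴ = Xᵀ * diagonal s := by
    rw [hW, conjTranspose_mul, diagonal_conjTranspose, hss]
    congr 1
    ext i j; simp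
  have hXX : Xᴴᵀ * Xᵀ = diagonal fun j => (v j : ℂ) := by
    rw [← transpose_mul, hX, diagonal_transpose]
  have hsv : ∀ j, (v j : ℂ) = Real.sqrt (v j) * Real.sqrt (v j) := fun j => by
    rw [← Complex.ofReal_mul, Real.mul_self_sqrt (hv j)]
  have hsvs : ∀ j, s j * v j * s j * s j = s j := fun j => by
    rw [hsv]
    by_cases h : (Real.sqrt (v j) : ℂ) = 0
    · simp [hs, h]
    · simp only [hs]; field_simp
  have hidem : W * Wᴴ * W = W := by
    have : W * Wᴴ * W = diagonal s * (Xᴴᵀ * Xᵀ) * diagonal s * diagonal s * Xᴴᵀ := by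
      rw [hWh, hW]; simp only [Matrix.mul_assoc]
    rw [this, hXX, diagonal_mul_diagonal, diagonal_mul_diagonal, diagonal_mul_diagonal, hW]
    simp only [hsvs]
  set Q : Matrix (Fin b) (Fin b) ℂ := 1 - Wᴴ * W with hQ
  have hQQ : Qᴴ * Q = 1 - Wᴴ * W := by
    have h1 : Qᴴ = Q := by
      rw [hQ, conjTranspose_sub, conjTranspose_one, conjTranspose_mul, conjTranspose_conjTranspose]
    have h2 : Wᴴ * W * (Wᴴ * W) = Wᴴ * W := by
      rw [Matrix.mul_assoc, ← Matrix.mul_assoc W, hidem]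
    rw [h1, hQ, Matrix.mul_sub, Matrix.mul_one, Matrix.sub_mul, Matrix.one_mul, h2, sub_self,
      sub_zero]
  -- Outcome 0 is `W`. The complementary projection `Q` is split into its `b` rows, each sent to the
  -- first basis vector, so that every outcome lives in dimension `M`.
  refine ⟨Fin.cons W fun x => of fun j k => if j = ⟨0, hM⟩ then Q x k else 0, ?_, ?_⟩
  · rw [Fin.sum_univ_succ]
    simp only [Fin.cons_zero, Fin.cons_succ]
    have : ∑ x : Fin b, (of fun (j : Fin M) k => if j = ⟨0, hM⟩ then Q x k else 0)ᴴ *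
        (of fun (j : Fin M) k => if j = ⟨0, hM⟩ then Q x k else 0) = Qᴴ * Q := by
      ext k k'
      simp only [Matrix.sum_apply, mul_apply, conjTranspose_apply, of_apply]
      refine Finset.sum_congr rfl fun x _ => ?_
      rw [Finset.sum_eq_single ⟨0, hM⟩] <;> simp +contextual
    rw [this, hQQ, add_sub_cancel]
  · rw [Fin.cons_zero, hWt, ← Matrix.mul_assoc, hX, diagonal_mul_diagonal, trace_diagonal]
    push_cast
    refine Finset.sum_congr rfl fun j _ => ?_
    rw [hsv]
    by_cases h : (Real.sqrt (v j) : ℂ) = 0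
    · simp [h]
    · simp only [hs]; field_simp

/-- The map onto the block number `l` among consecutive blocks of `M` coordinates. -/
def blockMap (a M l : ℕ) : Matrix (Fin M) (Fin a) ℂ :=
  of fun j i => if (i : ℕ) = l * M + j then 1 else 0

/-- Since `i / M ≤ i < a`, block numbers below `a` reach every coordinate; surplus blocks are zero.
-/
theorem sum_blockMap {a M : ℕ} (hM : 0 < M) :
    ∑ l : Fin a, (blockMap a M l)ᴴ * blockMap a M l = 1 := by
  ext i i'
  simp only [Matrix.sum_apply, mul_apply, conjTranspose_apply, blockMap, of_apply]
  rw [← Fintype.sum_prod_type' (f := fun (l : Fin a) (j : Fin M) =>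
    star (if (i : ℕ) = l * M + j then (1 : ℂ) else 0) * if (i' : ℕ) = l * M + j then 1 else 0)]
  have hi : (i : ℕ) = i / M * M + i % M := (Nat.div_add_mod' _ _).symm
  rw [Finset.sum_eq_single (⟨i / M, (Nat.div_le_self _ _).trans_lt i.2⟩,
    ⟨i % M, Nat.mod_lt _ hM⟩)]
  · simp only [← hi, if_true, star_one, one_mul, one_apply, Fin.ext_iff, eq_comm]
  · rintro ⟨l, j⟩ - hne
    rw [if_neg, star_zero, zero_mul]
    intro h
    apply hne
    have := (Nat.div_mod_unique hM).mpr ⟨(by rw [h]; ring : (j : ℕ) + M * l = i), j.2⟩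
    ext
    · exact this.1.symm
    · exact this.2.symm
  · simp

/-- The extension of a finite sequence by zero. -/
def extendZero {a : ℕ} (w : Fin a → ℝ) (i : ℕ) : ℝ := if h : i < a then w ⟨i, h⟩ else 0

theorem extendZero_nonneg {a : ℕ} {w : Fin a → ℝ} (hw : ∀ i, 0 ≤ w i) (i : ℕ) :
    0 ≤ extendZero w i := by
  unfold extendZero; split_ifs
  · exact hw _
  · exact le_rfl

theorem antitone_extendZero {a : ℕ} {w : Fin a → ℝ} (hw : ∀ i, 0 ≤ w i) (ha : Antitone w) :
    Antitone (extendZero w) := by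
  intro i j hij
  by_cases hj : j < a
  · simp only [extendZero, hj, hij.trans_lt hj, dif_pos]
    exact ha hij
  · rw [extendZero, dif_neg hj]
    exact extendZero_nonneg hw i

theorem blockMap_mul_diagonal {a M l : ℕ} (w : Fin a → ℝ) :
    blockMap a M l * diagonal (fun i => (w i : ℂ)) * (blockMap a M l)ᴴ =
      diagonal fun j : Fin M => ((extendZero w (l * M + j) : ℝ) : ℂ) := by
  ext j j'
  rw [mul_apply]
  simp only [mul_diagonal, conjTranspose_apply, blockMap, of_apply]
  by_cases h : l * M + j < a
  · rw [Finset.sum_eq_single ⟨l * M + j, h⟩]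
    · by_cases hj : j = j'
      · simp [hj, extendZero, hj ▸ h]
      · simp [hj, Fin.ext_iff.not.mp hj]
    · intro i _ hi
      rw [if_neg fun h' => hi (Fin.ext h')]; simp
    · simp
  · rw [Finset.sum_eq_zero]
    · simp [diagonal_apply, extendZero, h]
    · intro i _
      rw [if_neg fun (h' : (i : ℕ) = l * M + j) => h (h' ▸ i.2)]; simp

/-- Alice measures which block of Schmidt vectors occurs and announces it; Bob then aligns his basis
with hers. Weights beyond `a` are padded by zero, as `M` need not divide `a`. -/
theorem exists_isLOCC_fidelity_ge_sum {a b M : ℕ} (hM : 0 < M) {A : Matrix (Fin a) (Fin b) ℂ}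
    {U : Matrix (Fin a) (Fin a) ℂ} {w : Fin a → ℝ} (hU : U * Uᴴ = 1) (hw0 : ∀ i, 0 ≤ w i)
    (hw : (Uᴴ * A) * (Uᴴ * A)ᴴ = diagonal (fun i => (w i : ℂ))) :
    ∃ T : BipartiteOp a b → BipartiteOp M M, IsLOCC T ∧
      ∑ l : Fin a, (∑ j : Fin M, Real.sqrt (extendZero w (l * M + j))) ^ 2 / M
        ≤ fidelity (T (pureOp A)) := by
  have hX : ∀ l : Fin a, (blockMap a M l * Uᴴ * A) * (blockMap a M l * Uᴴ * A)ᴴ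
      = diagonal fun j : Fin M => ((extendZero w (l * M + j) : ℝ) : ℂ) := fun l => by
    rw [← blockMap_mul_diagonal, ← hw]
    simp only [conjTranspose_mul, Matrix.mul_assoc]
  choose K hK hKt using fun l : Fin a =>
    exists_aligning_measurement hM (fun j => extendZero_nonneg hw0 _) (hX l)
  have hA : ∑ l : Fin a, (blockMap a M l * Uᴴ)ᴴ * (blockMap a M l * Uᴴ) = 1 := by
    have : ∀ l : Fin a, (blockMap a M l * Uᴴ)ᴴ * (blockMap a M l * Uᴴ)
        = U * ((blockMap a M l)ᴴ * blockMap a M l) * Uᴴ := fun l => by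
      simp only [conjTranspose_mul, conjTranspose_conjTranspose, Matrix.mul_assoc]
    simp only [this]
    rw [← Matrix.sum_mul, ← Matrix.mul_sum, sum_blockMap hM, Matrix.mul_one, hU]
  have hB := fun l : Fin a => IsLOCC.bob (fun _ => M) (K l) (hK l)
    (fun _ X => X) (fun _ => IsLOCC.done (c := M) (d := M))
  refine ⟨_, IsLOCC.alice (fun _ => M) (fun l : Fin a => blockMap a M l * Uᴴ) hA _ hB, ?_⟩
  rw [fidelity_sum]
  refine Finset.sum_le_sum fun l _ => ?_
  rw [alice_pureOp, fidelity_sum]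
  -- Only Bob's successful outcome 0 is counted; the others contribute nonnegatively.
  refine le_trans (le_of_eq ?_) (Finset.single_le_sum (fun i _ => ?_) (Finset.mem_univ 0))
  · rw [bob_pureOp, fidelity_pureOp, hKt, Complex.norm_real, Real.norm_eq_abs, sq_abs]
  · rw [bob_pureOp, fidelity_pureOp]; positivity

theorem sum_blocks (g : ℕ → ℝ) (a M : ℕ) :
    ∑ l : Fin a, ∑ j : Fin M, g (l * M + j) = ∑ i ∈ Finset.range (a * M), g i := by
  induction a with
  | zero => simp
  | succ a ih =>
    rw [Fin.sum_univ_castSucc, Nat.succ_mul, Finset.sum_range_add, ← ih,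
      Finset.sum_range (fun x => g (a * M + x))]
    simp

theorem sum_extendZero {a n : ℕ} (w : Fin a → ℝ) (hn : a ≤ n) (f : ℝ → ℝ) (hf : f 0 = 0) :
    ∑ i ∈ Finset.range n, f (extendZero w i) = ∑ i, f (w i) := by
  rw [← Finset.sum_subset (Finset.range_subset_range.mpr hn), Finset.sum_range]
  · simp [extendZero]
  · intro i _ hi
    rw [extendZero, dif_neg (by simpa using hi), hf]

theorem sum_le_sq_sum_sqrt {ι : Type*} (s : Finset ι) (v : ι → ℝ) (hv : ∀ i, 0 ≤ v i) :
    ∑ i ∈ s, v i ≤ (∑ i ∈ s, Real.sqrt (v i)) ^ 2 := by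
  calc ∑ i ∈ s, v i = ∑ i ∈ s, Real.sqrt (v i) ^ 2 :=
      Finset.sum_congr rfl fun i _ => (Real.sq_sqrt (hv i)).symm
    _ ≤ _ := Finset.sum_sq_le_sq_sum_of_nonneg fun i _ => Real.sqrt_nonneg _

/-- The direct bounds. -/
theorem exists_isLOCC_fidelity_ge {a b M : ℕ} (hM : 0 < M) {A : Matrix (Fin a) (Fin b) ℂ}
    (hA : frobSq A = 1) :
    ∃ T : BipartiteOp a b → BipartiteOp M M, IsLOCC T ∧ 1 / M ≤ fidelity (T (pureOp A)) ∧
      ∀ t, 0 ≤ t → 1 - excess (A * Aᴴ) t - M * t ≤ fidelity (T (pureOp A)) := by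
  obtain ⟨U, w, -, hU, hanti, hw0, hw, hex⟩ := exists_schmidt A
  obtain ⟨T, hT, hF⟩ := exists_isLOCC_fidelity_ge_sum hM hU hw0 hw
  have hsum : ∑ i, w i = 1 := (sum_schmidt_weights hU hw).trans hA
  set g := extendZero w with hg
  have hg0 : ∀ i, 0 ≤ g i := extendZero_nonneg hw0
  have hganti : Antitone g := antitone_extendZero hw0 hanti
  have hMpos : (0 : ℝ) < M := by exact_mod_cast hM
  have haM : a ≤ a * M := Nat.le_mul_of_pos_right a hM
  refine ⟨T, hT, le_trans ?_ hF, fun t ht => le_trans ?_ hF⟩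
  · calc (1 : ℝ) / M = ∑ l : Fin a, (∑ j : Fin M, g (l * M + j)) / M := by
          rw [← Finset.sum_div, sum_blocks, ← hsum, hg]
          congr 1
          exact (sum_extendZero w haM id rfl).symm
      _ ≤ _ := by
          refine Finset.sum_le_sum fun l _ => ?_
          gcongr
          exact sum_le_sq_sum_sqrt _ _ fun j => hg0 _
  -- Every weight in block `l` is at least the first weight of block `l + 1`, which in turn
  -- dominates the rest of that block.
  · have hblock : ∀ l : Fin a, ∑ j : Fin M, g (M + (l * M + j))
        ≤ (∑ j : Fin M, Real.sqrt (g (l * M + j))) ^ 2 / M := fun l => by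
      have h1 : M * Real.sqrt (g (M + l * M)) ≤ ∑ j : Fin M, Real.sqrt (g (l * M + j)) := by
        calc M * Real.sqrt (g (M + l * M)) = ∑ j : Fin M, Real.sqrt (g (M + l * M)) := by simp
          _ ≤ _ := Finset.sum_le_sum fun j _ => Real.sqrt_le_sqrt (hganti (by omega))
      calc ∑ j : Fin M, g (M + (l * M + j)) ≤ ∑ j : Fin M, g (M + l * M) :=
            Finset.sum_le_sum fun j _ => hganti (by omega)
        _ = (M * Real.sqrt (g (M + l * M))) ^ 2 / M := by
            rw [mul_pow, Real.sq_sqrt (hg0 _)]; simp; field_simp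
        _ ≤ _ := by gcongr
    refine le_trans ?_ (Finset.sum_le_sum fun l _ => hblock l)
    rw [sum_blocks (fun i => g (M + i))]
    -- The range has length `M + a * M` so that the first block can be split off; truncating at `t`
    -- costs at most `M * t` there.
    have h1 : 1 - excess (A * Aᴴ) t = ∑ i ∈ Finset.range (M + a * M), min (g i) t := by
      rw [sum_extendZero w (haM.trans (Nat.le_add_left _ _)) (fun x => min x t) (by simpa using ht),
        hex, ← hsum, ← Finset.sum_sub_distrib]
      refine Finset.sum_congr rfl fun i _ => ?_
      rcases le_total (w i) t with h | h
      · rw [max_eq_right (by linarith), min_eq_left h, sub_zero]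
      · rw [max_eq_left (by linarith), min_eq_right h]; ring
    have h2 : ∑ i ∈ Finset.range M, min (g i) t ≤ M * t := by
      calc _ ≤ ∑ i ∈ Finset.range M, t := Finset.sum_le_sum fun i _ => min_le_right _ _
        _ = M * t := by simp
    have h3 : ∑ i ∈ Finset.range (a * M), min (g (M + i)) t
        ≤ ∑ i ∈ Finset.range (a * M), g (M + i) :=
      Finset.sum_le_sum fun i _ => min_le_left _ _
    rw [h1, Finset.sum_range_add]
    linarith

/-! ### The strong converse rate -/

/-- The coefficient matrix of a bipartite vector. -/
def coeffMatrix {a b : ℕ} (ψ : EuclideanSpace ℂ (Fin a × Fin b)) : Matrix (Fin a) (Fin b) ℂ :=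
  of fun i j => ψ (i, j)

theorem pureState_eq_pureOp {a b : ℕ} (ψ : EuclideanSpace ℂ (Fin a × Fin b)) :
    pureState ψ = pureOp (coeffMatrix ψ) := rfl

theorem traceB_pureState {a b : ℕ} (ψ : EuclideanSpace ℂ (Fin a × Fin b)) :
    traceB (pureState ψ) = coeffMatrix ψ * (coeffMatrix ψ)ᴴ := by
  ext i j
  simp [traceB, pureState, coeffMatrix, mul_apply]

theorem traceA_pureState {a b : ℕ} (ψ : EuclideanSpace ℂ (Fin a × Fin b)) :
    traceA (pureState ψ) = (coeffMatrix ψ)ᵀ * (coeffMatrix ψ)ᵀᴴ := by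
  ext i j
  simp [traceA, pureState, coeffMatrix, mul_apply]

theorem frobSq_coeffMatrix {a b : ℕ} {ψ : EuclideanSpace ℂ (Fin a × Fin b)} (hψ : ‖ψ‖ = 1) :
    frobSq (coeffMatrix ψ) = 1 := by
  have := EuclideanSpace.norm_sq_eq ψ
  rw [hψ, Fintype.sum_prod_type] at this
  simpa [frobSq, coeffMatrix] using this.symm

theorem tendsto_exp_nat_mul {c : ℝ} (hc : c < 0) :
    Tendsto (fun n : ℕ => Real.exp (n * c)) atTop (𝓝 0) :=
  Real.tendsto_exp_atBot.comp (tendsto_natCast_atTop_atTop.atTop_mul_const_of_neg hc)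

section Rates

variable {a b : ℕ → ℕ} {φ : ∀ n, EuclideanSpace ℂ (Fin (a n) × Fin (b n))}

/-- The excess of the reduced state of `φ n` over the threshold `exp (n γ)`. -/
noncomputable def reducedExcess (φ : ∀ n, EuclideanSpace ℂ (Fin (a n) × Fin (b n))) (γ : ℝ)
    (n : ℕ) : ℝ :=
  excess (coeffMatrix (φ n) * (coeffMatrix (φ n))ᴴ) (Real.exp (n * γ))

theorem reducedExcess_le_one (hφ : ∀ n, ‖φ n‖ = 1) (γ : ℝ) (n : ℕ) : reducedExcess φ γ n ≤ 1 :=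
  excess_le_one (frobSq_coeffMatrix (hφ n)) (Real.exp_pos _).le

/-- The excess never exceeds 1, so a lower limit of 1 already forces convergence. -/
theorem liminf_reducedExcess_eq_one_iff (hφ : ∀ n, ‖φ n‖ = 1) (γ : ℝ) :
    liminf (reducedExcess φ γ) atTop = 1 ↔ Tendsto (reducedExcess φ γ) atTop (𝓝 1) := by
  have hle := reducedExcess_le_one hφ γ
  have hA : IsBoundedUnder (· ≤ ·) atTop (reducedExcess φ γ) := isBoundedUnder_of ⟨1, hle⟩
  have hB : IsBoundedUnder (· ≥ ·) atTop (reducedExcess φ γ) :=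
    isBoundedUnder_of ⟨0, fun n => excess_nonneg _ _⟩
  refine ⟨fun h => tendsto_of_le_liminf_of_limsup_le h.ge ?_ hA hB, fun h => h.liminf_eq⟩
  exact limsup_le_of_le hB.isCoboundedUnder_le (Eventually.of_forall hle)

theorem fidelitySeq_nonneg (P : Protocol a b) (n : ℕ) : 0 ≤ P.fidelitySeq φ n := by
  rw [Protocol.fidelitySeq, pureState_eq_pureOp]
  exact (P.isLOCC n).fidelity_nonneg _

theorem Protocol.tendsto_fidelitySeq (hφ : ∀ n, ‖φ n‖ = 1) {γ R : ℝ} (hR : -γ < R)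
    (hγ : Tendsto (reducedExcess φ γ) atTop (𝓝 1)) (P : Protocol a b) (hP : P.HasRate R) :
    Tendsto (P.fidelitySeq φ) atTop (𝓝 0) := by
  have hlim : Tendsto (fun n : ℕ => 2 * Real.exp (n * (-(R + γ))) + 2 * (1 - reducedExcess φ γ n))
      atTop (𝓝 0) := by
    have h := ((tendsto_exp_nat_mul (c := -(R + γ)) (by linarith)).const_mul 2).add
      ((hγ.const_sub 1).const_mul 2)
    simpa using h
  refine tendsto_of_tendsto_of_tendsto_of_le_of_le' tendsto_const_nhds hlim
    (Eventually.of_forall fun n => fidelitySeq_nonneg P n) ?_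
  filter_upwards [hP, eventually_gt_atTop 0] with n hn hn0
  have hn0' : (0 : ℝ) < n := by exact_mod_cast hn0
  have hMpos : (0 : ℝ) < P.M n := by exact_mod_cast P.M_pos n
  have hM : Real.exp (n * R) ≤ P.M n := by
    rw [← Real.le_log_iff_exp_le hMpos, mul_comm]
    exact (le_div_iff₀ hn0').mp hn
  refine ((P.isLOCC n).fidelity_le_excess (frobSq_coeffMatrix (hφ n))
    (Real.exp_pos (n * γ))).trans (add_le_add ?_ le_rfl)
  calc 2 / (P.M n * Real.exp (n * γ)) ≤ 2 / (Real.exp (n * R) * Real.exp (n * γ)) := by gcongr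
    _ = 2 * Real.exp (n * (-(R + γ))) := by
      rw [← Real.exp_add, div_eq_mul_inv, ← Real.exp_neg]
      ring_nf

/-- The hypothesis is tested on the block protocol with `M n = ⌈exp (n R)⌉`. -/
theorem tendsto_reducedExcess (hφ : ∀ n, ‖φ n‖ = 1) {γ R : ℝ} (hR : γ < -R)
    (h : ∀ P : Protocol a b, P.HasRate R → Tendsto (P.fidelitySeq φ) atTop (𝓝 0)) :
    Tendsto (reducedExcess φ γ) atTop (𝓝 1) := by
  have hceil : ∀ n : ℕ, 0 < ⌈Real.exp (n * R)⌉₊ := fun n => Nat.ceil_pos.mpr (Real.exp_pos _)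
  choose T hT hT1 hT2 using fun n =>
    exists_isLOCC_fidelity_ge (hceil n) (frobSq_coeffMatrix (hφ n))
  let P : Protocol a b := ⟨fun n => ⌈Real.exp (n * R)⌉₊, hceil, T, hT⟩
  have hP : P.HasRate R := by
    filter_upwards [eventually_gt_atTop 0] with n hn0
    have hn0' : (0 : ℝ) < n := by exact_mod_cast hn0
    rw [le_div_iff₀ hn0', Real.le_log_iff_exp_le (by exact_mod_cast hceil n), mul_comm]
    exact Nat.le_ceil _
  have hF := h P hP
  -- For `R ≤ 0` the test protocol has `M n = 1`, and the bound `1 / M ≤ F` contradicts F → 0. Hence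
  -- `γ < -R < 0`.
  have hRpos : 0 < R := by
    by_contra! hR0
    have : ∀ n, 1 ≤ P.fidelitySeq φ n := fun n => by
      refine le_trans ?_ (hT1 n)
      have : ⌈Real.exp (n * R)⌉₊ = 1 := by
        refine le_antisymm (Nat.ceil_le.mpr ?_) (hceil n)
        simpa using mul_nonpos_of_nonneg_of_nonpos (Nat.cast_nonneg n) hR0
      rw [this]; norm_num
    exact absurd (ge_of_tendsto' hF this) (by norm_num)
  have hlim : Tendsto (fun n : ℕ =>
      1 - (P.fidelitySeq φ n + (Real.exp (n * (R + γ)) + Real.exp (n * γ)))) atTop (𝓝 1) := by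
    have h := (hF.add ((tendsto_exp_nat_mul (c := R + γ) (by linarith)).add
      (tendsto_exp_nat_mul (c := γ) (by linarith)))).const_sub 1
    simpa using h
  refine tendsto_of_tendsto_of_tendsto_of_le_of_le hlim tendsto_const_nhds (fun n => ?_)
    (reducedExcess_le_one hφ γ)
  have h1 : 1 - reducedExcess φ γ n - ⌈Real.exp (n * R)⌉₊ * Real.exp (n * γ)
      ≤ P.fidelitySeq φ n := hT2 n _ (Real.exp_pos (n * γ)).le
  -- Rounding up costs an additional `exp (n γ)`, which vanishes because `γ < 0`.
  have h2 : ⌈Real.exp (n * R)⌉₊ * Real.exp (n * γ)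
      ≤ Real.exp (n * (R + γ)) + Real.exp (n * γ) := by
    rw [mul_add, Real.exp_add, ← add_one_mul]
    gcongr
    exact (Nat.ceil_lt_add_one (Real.exp_pos _).le).le
  simp only
  linarith

/-- Only the excess of `ρ` at nonnegative thresholds matters, so one argument serves both
subsystems. The strict inequalities between `R` and `-γ` suffice because an extended real is
determined by the reals on either side of it; infinite values need no separate case. -/
theorem strongConverseRate_eq (hφ : ∀ n, ‖φ n‖ = 1) {d : ℕ → ℕ}
    (ρ : ∀ n, Matrix (Fin (d n)) (Fin (d n)) ℂ)
    (hρ : ∀ n t, 0 ≤ t →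
      excess (ρ n) t = excess (coeffMatrix (φ n) * (coeffMatrix (φ n))ᴴ) t) :
    strongConverseRate φ = supEntropyRate ρ := by
  have hset : {γ : ℝ | liminf (fun n => ((nonnegProj (diffOp ρ (fun _ => 1) γ n) *
      diffOp ρ (fun _ => 1) γ n).trace).re) atTop = 1}
      = {γ : ℝ | Tendsto (reducedExcess φ γ) atTop (𝓝 1)} := by
    ext γ
    have : (fun n => ((nonnegProj (diffOp ρ (fun _ => 1) γ n) *
        diffOp ρ (fun _ => 1) γ n).trace).re) = reducedExcess φ γ :=
      funext fun n => hρ n _ (Real.exp_pos _).le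
    rw [Set.mem_ofPred_eq, Set.mem_ofPred_eq, this, liminf_reducedExcess_eq_one_iff hφ]
  rw [strongConverseRate, supEntropyRate, infDivergenceRate, hset]
  apply le_antisymm
  · rw [EReal.le_neg]
    refine sSup_le ?_
    rintro _ ⟨γ, hγ, rfl⟩
    rw [EReal.le_neg]
    refine EReal.le_of_forall_lt_iff_le.mp fun R hR => sInf_le ⟨R, fun P hP => ?_, rfl⟩
    exact P.tendsto_fidelitySeq hφ (EReal.coe_lt_coe_iff.mp hR) hγ hP
  · refine le_sInf ?_
    rintro _ ⟨R, hR, rfl⟩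
    rw [EReal.neg_le]
    refine EReal.ge_of_forall_gt_iff_ge.mp fun γ hγ => le_sSup ⟨γ, ?_, rfl⟩
    exact tendsto_reducedExcess hφ (EReal.coe_lt_coe_iff.mp hγ) hR

end Rates

end EntanglementConcentration

theorem mainTheorem5 (a b : ℕ → ℕ)
    (φ : ∀ n, EuclideanSpace ℂ (Fin (a n) × Fin (b n))) (hφ : ∀ n, ‖φ n‖ = 1) :
    EntanglementConcentration.strongConverseRate φ =
        EntanglementConcentration.supEntropyRate
          (fun n => EntanglementConcentration.traceA (EntanglementConcentration.pureState (φ n))) ∧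
      EntanglementConcentration.strongConverseRate φ =
        EntanglementConcentration.supEntropyRate
          (fun n => EntanglementConcentration.traceB (EntanglementConcentration.pureState (φ n))) := by
  refine ⟨EntanglementConcentration.strongConverseRate_eq hφ _ fun n t ht => ?_,
    EntanglementConcentration.strongConverseRate_eq hφ _ fun n t _ => ?_⟩
  · rw [EntanglementConcentration.traceA_pureState,
      EntanglementConcentration.excess_transpose_mul _ ht]
  · rw [EntanglementConcentration.traceB_pureState]
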